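/- Let $x=(x_1,\dots,x_n)$ and let $(c_i)_{i\in\mathcal E}$, $(c_j)_{j\in\mathcal I}$ be finite tuples of polynomials in $\mathbb R[x]$. Set $$K=\{x\in\mathbb R^n:\ c_i(x)=0\ (i\in\mathcal E),\ c_j(x)\ge 0\ (j\in\mathcal I)\}.$$ Write $\tilde x=(x_0,x)$, and for $p\in\mathbb R[x]$ let $\tilde p(\tilde x)=x_0^{\deg p}\,p(x/x_0)\in\mathbb R[\tilde x]$ be its homogenization. Let $$\widetilde K^h=\{\tilde x\in\mathbb R^{n+1}:\ \tilde c_i(\tilde x)=0\ (i\in\mathcal E),\ \tilde c_j(\tilde x)\ge 0\ (j\in\mathcal I),\ x_0\ge 0\},\qquad \widetilde K^c=\widetilde K^h\cap\{x_0>0\}.$$ $K$ (with these describing polynomials) is called closed at $\infty$ if $\mathrm{cl}(\widetilde K^c)=\widetilde K^h$. Let $\mathcal A\subset\mathbb N^n$ be finite and $d=\max\{|\alpha|:\alpha\in\mathcal A\}$ (with $d=0$ if $\mathcal A=\emptyset$). Let $\mathbb R[x]_{\mathcal A}=\mathrm{Span}\{x^\alpha:\alpha\in\mathcal A\}$, and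 let $\mathscr P_d(K)$ be the cone of polynomials of degree at most $d$ that are nonnegative on $K$; its interior is taken in the finite-dimensional space $\mathbb R[x]_d$ of polynomials of degree at most $d$. Let $\mathscr R_{\mathcal A}(K)$ be the set of $y=(y_\alpha)_{\alpha\in\mathcal A}\in\mathbb R^{\mathcal A}$ for which there is a (nonnegative) Borel measure $\mu$ on $\mathbb R^n$ with $\mathrm{supp}(\mu)\subseteq K$ such that, for every $\alpha\in\mathcal A$, the monomial $x^\alpha$ is $\mu$-integrable and $y_\alpha=\int x^\alpha\,d\mu$. Put $\tilde{\mathcal A}=\{(d-|\alpha|,\alpha):\alpha\in\mathcal A\}\subset\mathbb N^{n+1}$ and let $\mathbb R[\tilde x]_{\tilde{\mathcal A}}$ be the span of the monomials with exponents in $\tilde{\mathcal A}$. For $y\in\mathbb R^{\mathcal A}$ define $\tilde y\in\mathbb R^{\tilde{\mathcal A}}$ by $\tilde y_{(d-|\alpha|,\alpha)}=y_\alpha$, and $$\mathscr L_{\tilde y}\Big(\sum_{\alpha\in\mathcal A}q_\alpha\,x_0^{d-|\alpha|}x^\alpha\Big)=\sum_{\alpha\in\mathcal A}q_\alpha y_\alpha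 .$$ Finally let $$\tilde c_{eq}=(\tilde c_i)_{i\in\mathcal E}\cup\{\|\tilde x\|^2-1\},\qquad \tilde c_{in}=(\tilde c_j)_{j\in\mathcal I}\cup\{x_0\}.$$ Here $\mathrm{Ideal}(h)$ is the ideal of $\mathbb R[\tilde x]$ generated by the tuple $h$, and $\mathrm{Qmod}(g)=\Sigma[\tilde x]+g_1\Sigma[\tilde x]+\cdots+g_\ell\Sigma[\tilde x]$ is the quadratic module generated by $g=(g_1,\dots,g_\ell)$, where $\Sigma[\tilde x]$ is the set of finite sums of squares of polynomials in $\mathbb R[\tilde x]$. **Lemma.** Suppose that $K$ is closed at $\infty$ and $\mathbb R[x]_{\mathcal A}\cap\mathrm{int}(\mathscr P_d(K))\neq\emptyset$. Then, for every $y\in\mathbb R^{\mathcal A}$, we have $y\notin\mathrm{cl}(\mathscr R_{\mathcal A}(K))$ if and only if there exists $q\in\mathbb R[\tilde x]_{\tilde{\mathcal A}}$ such that $$\mathscr L_{\tilde y}(q)<0\qquad\text{and}\qquad q\in\mathrm{Ideal}(\tilde c_{eq})+\mathrm{Qmod}(\tilde c_{in}).$$ -/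

import Mathlib

open scoped Pointwise

namespace TruncatedMoment

noncomputable section

/-- The set `ℕ^n_d` of all exponents `α` with `|α| ≤ d`. -/
def expLE (n d : ℕ) : Finset (Fin n →₀ ℕ) :=
  (Finset.range (d + 1)).biUnion fun k => Finset.finsuppAntidiag Finset.univ k

theorem mem_expLE {n d : ℕ} {α : Fin n →₀ ℕ} : α ∈ expLE n d ↔ α.degree ≤ d := by
  simp [expLE, Finset.mem_finsuppAntidiag, Finsupp.degree_eq_sum]

/-- The degree `deg(A) = max {|α| : α ∈ A}` (with `deg(∅) = 0`). -/
def expDeg {n : ℕ} (A : Finset (Fin n →₀ ℕ)) : ℕ :=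
  A.sup fun α => α.degree

/-- The space `ℝ[x]_A` spanned by the monomials `x^α`, `α ∈ A`. -/
def polySpace {n : ℕ} (A : Finset (Fin n →₀ ℕ)) : Submodule ℝ (MvPolynomial (Fin n) ℝ) :=
  MvPolynomial.restrictSupport ℝ (A : Set (Fin n →₀ ℕ))

/-- The coefficient vector `(p_α)_{α ∈ A}`; on `ℝ[x]_A` it is a linear isomorphism onto `ℝ^A`. -/
def coeffVec {n : ℕ} (A : Finset (Fin n →₀ ℕ)) (p : MvPolynomial (Fin n) ℝ) : A → ℝ :=
  fun α => MvPolynomial.coeff (α : Fin n →₀ ℕ) p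

/-- The interior of `S ⊆ ℝ[x]_A` relative to the finite-dimensional space `ℝ[x]_A`, whose
Euclidean topology is the one transported from `ℝ^A` by coefficient vectors. -/
def polyInterior {n : ℕ} (A : Finset (Fin n →₀ ℕ)) (S : Set (MvPolynomial (Fin n) ℝ)) :
    Set (MvPolynomial (Fin n) ℝ) :=
  {p | p ∈ polySpace A ∧ coeffVec A p ∈ interior (coeffVec A '' S)}

/-- The Riesz functional `L_y(∑ p_α x^α) = ∑ p_α y_α` on `ℝ[x]_A` of `y ∈ ℝ^A`. -/
def riesz {n : ℕ} (A : Finset (Fin n →₀ ℕ)) (y : A → ℝ) (p : MvPolynomial (Fin n) ℝ) : ℝ :=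
  ∑ α : A, MvPolynomial.coeff (α : Fin n →₀ ℕ) p * y α

/-- The cone `P_A(K)` of polynomials in `ℝ[x]_A` that are nonnegative on `K`. -/
def nonnegCone {n : ℕ} (A : Finset (Fin n →₀ ℕ)) (K : Set (Fin n → ℝ)) :
    Set (MvPolynomial (Fin n) ℝ) :=
  {p | p ∈ polySpace A ∧ ∀ x ∈ K, 0 ≤ MvPolynomial.eval x p}

/-- `μ` is a `K`-representing measure of `y`: its support is contained in `K`, and for all
`α ∈ A` the `α`-th moment of `μ` exists and equals `y_α`. -/
def IsRepresenting {n : ℕ} (A : Finset (Fin n →₀ ℕ)) (K : Set (Fin n → ℝ)) (y : A → ℝ)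
    (μ : MeasureTheory.Measure (Fin n → ℝ)) : Prop :=
  μ.support ⊆ K ∧ ∀ α : A,
    MeasureTheory.Integrable (fun x : Fin n → ℝ => ∏ i, x i ^ (α : Fin n →₀ ℕ) i) μ ∧
    ∫ x : Fin n → ℝ, ∏ i, x i ^ (α : Fin n →₀ ℕ) i ∂μ = y α

/-- The `A`-truncated moment cone `R_A(K)`. -/
def momentCone {n : ℕ} (A : Finset (Fin n →₀ ℕ)) (K : Set (Fin n → ℝ)) : Set (A → ℝ) :=
  {y | ∃ μ : MeasureTheory.Measure (Fin n → ℝ), IsRepresenting A K y μ}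

/-- The basic closed semialgebraic set `c_i = 0 (i ∈ E)`, `c_j ≥ 0 (j ∈ I)`. -/
def semialgSet {n : ℕ} {E I : Type*} (cE : E → MvPolynomial (Fin n) ℝ)
    (cI : I → MvPolynomial (Fin n) ℝ) : Set (Fin n → ℝ) :=
  {x | (∀ i, MvPolynomial.eval x (cE i) = 0) ∧ ∀ j, 0 ≤ MvPolynomial.eval x (cI j)}

/-- The homogenization `x₀^{deg p} p(x/x₀)`; the new variable `x₀` has index `0`, and the
variable with index `i` becomes the one with index `i.succ`. -/
def homogenization {n : ℕ} (p : MvPolynomial (Fin n) ℝ) : MvPolynomial (Fin (n + 1)) ℝ :=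
  ∑ α ∈ p.support,
    MvPolynomial.monomial (Finsupp.cons (p.totalDegree - α.degree) α) (MvPolynomial.coeff α p)

/-- The cone `K̃^h` cut out by the homogenized constraints and `x₀ ≥ 0`. -/
def homCone {n : ℕ} {E I : Type*} (cE : E → MvPolynomial (Fin n) ℝ)
    (cI : I → MvPolynomial (Fin n) ℝ) : Set (Fin (n + 1) → ℝ) :=
  {z | (∀ i, MvPolynomial.eval z (homogenization (cE i)) = 0) ∧
    (∀ j, 0 ≤ MvPolynomial.eval z (homogenization (cI j))) ∧ 0 ≤ z 0}

/-- `K` (through its describing polynomials) is closed at infinity: `cl(K̃^c) = K̃^h`, where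
`K̃^c = K̃^h ∩ {x₀ > 0}`. -/
def ClosedAtInfinity {n : ℕ} {E I : Type*} (cE : E → MvPolynomial (Fin n) ℝ)
    (cI : I → MvPolynomial (Fin n) ℝ) : Prop :=
  closure (homCone cE cI ∩ {z | 0 < z 0}) = homCone cE cI

/-- The homogenized power set `Ã = {(d - |α|, α) : α ∈ A}`, `d = deg(A)`. -/
def expTilde {n : ℕ} (A : Finset (Fin n →₀ ℕ)) : Finset (Fin (n + 1) →₀ ℕ) :=
  A.image fun α => Finsupp.cons (expDeg A - α.degree) α

theorem tail_mem_of_mem_expTilde {n : ℕ} {A : Finset (Fin n →₀ ℕ)} {β : Fin (n + 1) →₀ ℕ}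
    (h : β ∈ expTilde A) : Finsupp.tail β ∈ A := by
  obtain ⟨α, hα, rfl⟩ := Finset.mem_image.1 h
  rwa [Finsupp.tail_cons]

/-- The homogenization `ỹ ∈ ℝ^Ã` of `y ∈ ℝ^A`, given by `ỹ_{(d - |α|, α)} = y_α`. -/
def tmsTilde {n : ℕ} {A : Finset (Fin n →₀ ℕ)} (y : A → ℝ) : expTilde A → ℝ :=
  fun β => y ⟨Finsupp.tail (β : Fin (n + 1) →₀ ℕ), tail_mem_of_mem_expTilde β.2⟩

/-- The tuple `c̃_eq`: the homogenized equality constraints and `‖x̃‖² - 1`. -/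
def tildeEq {n : ℕ} {E : Type*} (cE : E → MvPolynomial (Fin n) ℝ) :
    Option E → MvPolynomial (Fin (n + 1)) ℝ
  | none => ∑ i, MvPolynomial.X i ^ 2 - 1
  | some i => homogenization (cE i)

/-- The tuple `c̃_in`: the homogenized inequality constraints and `x₀`. -/
def tildeIn {n : ℕ} {I : Type*} (cI : I → MvPolynomial (Fin n) ℝ) :
    Option I → MvPolynomial (Fin (n + 1)) ℝ
  | none => MvPolynomial.X 0
  | some j => homogenization (cI j)

/-- The quadratic module `Σ[x] + g₁ Σ[x] + ⋯ + g_ℓ Σ[x]` generated by a finite tuple `g`. -/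
def qmod {m : ℕ} {ι : Type*} [Fintype ι] (g : ι → MvPolynomial (Fin m) ℝ) :
    Set (MvPolynomial (Fin m) ℝ) :=
  {p | ∃ (σ₀ : MvPolynomial (Fin m) ℝ) (σ : ι → MvPolynomial (Fin m) ℝ),
    IsSumSq σ₀ ∧ (∀ j, IsSumSq (σ j)) ∧ p = σ₀ + ∑ j, g j * σ j}

/-- The ideal generated by a tuple `h`. -/
def idealOf {m : ℕ} {ι : Type*} (h : ι → MvPolynomial (Fin m) ℝ) :
    Ideal (MvPolynomial (Fin m) ℝ) :=
  Ideal.span (Set.range h)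

end

end TruncatedMoment

/-! The moment cone is convex and contains the Dirac moments of the points of the closed set `K`. By
Hahn–Banach (`exists_riesz_neg`), a `y` outside its closure is therefore cut off by some `p ∈
ℝ[x]_A` that is nonnegative on `K` and has negative Riesz value. Nonnegativity alone does not give a
certificate, so `p` is replaced by `p + ε f`, with `f ∈ ℝ[x]_A` interior to `P_d(K)` and `ε` small.
Closedness at infinity carries nonnegativity on `K` to the homogenization on `K̃^h`
(`eval_homogenizeAt_nonneg`). Interiority makes the homogenization of `f` strictly positive there
off the origin (`eval_homogenizeAt_pos`). The perturbed form is thus positive on the part of `K̃^h`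
in the unit sphere, and Putinar's theorem (`mem_ideal_add_qmod_of_pos`) gives the certificate.

Conversely, a certified form is nonnegative on that part of the sphere. Scaling `(1, x)` onto it
shows that the dehomogenized polynomial is nonnegative on `K`, so its Riesz value is nonnegative on
the closed moment cone.

Putinar's theorem is proved algebraically: a maximal proper archimedean quadratic module yields a
real character, and the real characters of a polynomial ring are point evaluations. -/

namespace TruncatedMoment

/-! ### Archimedean quadratic modules and the abstract Positivstellensatz. -/

/-- Quadratic modules of a commutative ring. -/
structure IsQuadModule {R : Type*} [CommRing R] (M : Set R) : Prop where
  one_mem : 1 ∈ M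
  add_mem : ∀ {a b}, a ∈ M → b ∈ M → a + b ∈ M
  sq_mul_mem : ∀ (c) {a}, a ∈ M → c ^ 2 * a ∈ M

/-- `M` is archimedean: every element is bounded, relative to `M`, by a real number. -/
def IsArchimedean {R : Type*} [CommRing R] [Algebra ℝ R] (M : Set R) : Prop :=
  ∀ a, ∃ N : ℝ, algebraMap ℝ R N - a ∈ M

namespace IsQuadModule

section Ring

variable {R : Type*} [CommRing R] {M : Set R}

theorem sq_mem (hM : IsQuadModule M) (a : R) : a ^ 2 ∈ M := by
  simpa using hM.sq_mul_mem a hM.one_mem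

theorem zero_mem (hM : IsQuadModule M) : (0 : R) ∈ M := by
  simpa using hM.sq_mem 0

theorem sumSq_mul_mem (hM : IsQuadModule M) {s a : R} (hs : IsSumSq s) (ha : a ∈ M) :
    s * a ∈ M := by
  induction hs with
  | zero => simpa using hM.zero_mem
  | sq_add c _ ih =>
    rw [add_mul, ← pow_two]
    exact hM.add_mem (hM.sq_mul_mem c ha) ih

theorem sumSq_mem (hM : IsQuadModule M) {s : R} (hs : IsSumSq s) : s ∈ M := by
  simpa using hM.sumSq_mul_mem hs hM.one_mem

theorem sum_mem (hM : IsQuadModule M) {ι : Type*} (t : Finset ι) {g : ι → R}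
    (hg : ∀ i ∈ t, g i ∈ M) : ∑ i ∈ t, g i ∈ M := by
  classical
  induction t using Finset.induction_on with
  | empty => simpa using hM.zero_mem
  | insert i t hi ih =>
    rw [Finset.sum_insert hi]
    exact hM.add_mem (hg i (by simp)) (ih fun j hj => hg j (by simp [hj]))

/-- Adjoining an element to a quadratic module. -/
theorem adjoin (hM : IsQuadModule M) (f : R) :
    IsQuadModule {p | ∃ m ∈ M, ∃ s, IsSumSq s ∧ p = m + f * s} where
  one_mem := ⟨1, hM.one_mem, 0, .zero, by simp⟩
  add_mem := by
    rintro _ _ ⟨m, hm, s, hs, rfl⟩ ⟨m', hm', s', hs', rfl⟩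
    exact ⟨m + m', hM.add_mem hm hm', s + s', hs.add hs', by ring⟩
  sq_mul_mem := by
    rintro c _ ⟨m, hm, s, hs, rfl⟩
    exact ⟨c ^ 2 * m, hM.sq_mul_mem c hm, c * c * s, (IsSumSq.mul_self c).mul hs, by ring⟩

/-- A quadratic module without `-1` lies in a maximal one. -/
theorem exists_maximal (hM : IsQuadModule M) (h : (-1 : R) ∉ M) :
    ∃ Q, M ⊆ Q ∧ Maximal (fun Q : Set R => IsQuadModule Q ∧ (-1 : R) ∉ Q) Q := by
  refine zorn_subset_nonempty {Q : Set R | IsQuadModule Q ∧ (-1 : R) ∉ Q} ?_ M ⟨hM, h⟩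
  intro c hc hchain ⟨Q₀, hQ₀⟩
  refine ⟨⋃₀ c, ⟨⟨⟨Q₀, hQ₀, (hc hQ₀).1.one_mem⟩, ?_, ?_⟩, ?_⟩,
    fun Q hQ => Set.subset_sUnion_of_mem hQ⟩
  · rintro a b ⟨Q, hQ, ha⟩ ⟨Q', hQ', hb⟩
    rcases hchain.total hQ hQ' with hle | hle
    · exact ⟨Q', hQ', (hc hQ').1.add_mem (hle ha) hb⟩
    · exact ⟨Q, hQ, (hc hQ).1.add_mem ha (hle hb)⟩
  · rintro d a ⟨Q, hQ, ha⟩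
    exact ⟨Q, hQ, (hc hQ).1.sq_mul_mem d ha⟩
  · rintro ⟨Q, hQ, ha⟩
    exact (hc hQ).2 ha

end Ring

section Algebra

variable {R : Type*} [CommRing R] [Algebra ℝ R] {M : Set R}

theorem smul_mem (hM : IsQuadModule M) {r : ℝ} (hr : 0 ≤ r) {a : R} (ha : a ∈ M) :
    r • a ∈ M := by
  have := hM.sq_mul_mem (algebraMap ℝ R (√r)) ha
  rwa [← map_pow, Real.sq_sqrt hr, ← Algebra.smul_def] at this

theorem algebraMap_mem (hM : IsQuadModule M) {r : ℝ} (hr : 0 ≤ r) : algebraMap ℝ R r ∈ M := by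
  simpa [Algebra.smul_def] using hM.smul_mem hr hM.one_mem

theorem of_smul_mem (hM : IsQuadModule M) {r : ℝ} (hr : 0 < r) {a : R} (ha : r • a ∈ M) :
    a ∈ M := by
  simpa [smul_smul, hr.ne'] using hM.smul_mem (inv_nonneg.2 hr.le) ha

/-- If `-ε ≤ a ≤ ε` modulo `M` then `a² ≤ ε²` modulo `M`. -/
theorem sq_sub_sq_mem (hM : IsQuadModule M) {ε : ℝ} (hε : 0 < ε) {a : R}
    (h₁ : algebraMap ℝ R ε - a ∈ M) (h₂ : algebraMap ℝ R ε + a ∈ M) :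
    algebraMap ℝ R (ε ^ 2) - a ^ 2 ∈ M := by
  -- `2ε(ε² - a²) = (ε + a)²(ε - a) + (ε - a)²(ε + a)`.
  refine hM.of_smul_mem (r := 2 * ε) (by positivity) ?_
  have := hM.add_mem (hM.sq_mul_mem (algebraMap ℝ R ε + a) h₁)
    (hM.sq_mul_mem (algebraMap ℝ R ε - a) h₂)
  convert this using 1
  rw [Algebra.smul_def]
  simp only [map_mul, map_pow, map_ofNat]
  ring

/-- By the polarization `4ba = (b + 1)² a + (b - 1)² (-a)`; hence `M ∩ -M` is an ideal. -/
theorem mul_mem_of_mem_neg_mem (hM : IsQuadModule M) {a : R} (h₁ : a ∈ M) (h₂ : -a ∈ M) (b : R) :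
    b * a ∈ M := by
  refine hM.of_smul_mem (r := 4) (by norm_num) ?_
  have := hM.add_mem (hM.sq_mul_mem (b + 1) h₁) (hM.sq_mul_mem (b - 1) h₂)
  convert this using 1
  rw [Algebra.smul_def, map_ofNat]
  ring

/-- A maximal proper quadratic module is a semiordering. -/
theorem mem_or_neg_mem_of_maximal {Q : Set R}
    (hQ : Maximal (fun Q : Set R => IsQuadModule Q ∧ (-1 : R) ∉ Q) Q) (a : R) :
    a ∈ Q ∨ -a ∈ Q := by
  have hq := hQ.prop.1
  have key : ∀ b, b ∉ Q → ∃ m ∈ Q, ∃ s, IsSumSq s ∧ -1 = m + b * s := by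
    intro b hb
    by_contra hcon
    have hle : Q ⊆ {p | ∃ m ∈ Q, ∃ s, IsSumSq s ∧ p = m + b * s} :=
      fun m hm => ⟨m, hm, 0, .zero, by simp⟩
    exact hb (hQ.le_of_ge ⟨hq.adjoin b, hcon⟩ hle ⟨0, hq.zero_mem, 1, IsSumSq.one, by simp⟩)
  by_contra! hcon
  obtain ⟨m₁, hm₁, s₁, hs₁, e₁⟩ := key a hcon.1
  obtain ⟨m₂, hm₂, s₂, hs₂, e₂⟩ := key (-a) hcon.2
  -- Cross-multiplying the two expressions for `-1` cancels `a s₁ s₂`, leaving `-s₁ = s₂ + s₂ m₁ +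
  -- s₁ m₂`. So `s₁` lies in the ideal `Q ∩ -Q`, and `-1 = m₁ + a s₁` falls into `Q`.
  have hneg : -s₁ ∈ Q := by
    have := hq.add_mem (hq.sumSq_mem hs₂)
      (hq.add_mem (hq.sumSq_mul_mem hs₂ hm₁) (hq.sumSq_mul_mem hs₁ hm₂))
    convert this using 1
    linear_combination s₂ * e₁ + s₁ * e₂
  refine hQ.prop.2 ?_
  rw [e₁]
  exact hq.add_mem hm₁ (hq.mul_mem_of_mem_neg_mem (hq.sumSq_mem hs₁) hneg a)

/-- A maximal proper archimedean quadratic module is nonnegative under some real character. -/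
theorem exists_algHom_of_maximal {Q : Set R}
    (hQ : Maximal (fun Q : Set R => IsQuadModule Q ∧ (-1 : R) ∉ Q) Q) (harch : IsArchimedean Q) :
    ∃ φ : R →ₐ[ℝ] ℝ, ∀ a ∈ Q, 0 ≤ φ a := by
  have hq := hQ.prop.1
  have hproper : ∀ r : ℝ, algebraMap ℝ R r ∈ Q → 0 ≤ r := by
    intro r hr
    by_contra! hneg
    refine hQ.prop.2 (hq.of_smul_mem (neg_pos.2 hneg) ?_)
    simpa [Algebra.smul_def] using hr
  -- The real lower bounds of `a` modulo `Q`. Their supremum is the value of the character at `a`;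
  -- since `Q` is a semiordering, every larger real is an upper bound.
  let S : R → Set ℝ := fun a => {r | a - algebraMap ℝ R r ∈ Q}
  have hne : ∀ a, (S a).Nonempty := by
    intro a
    obtain ⟨N, hN⟩ := harch (-a)
    exact ⟨-N, by simpa [S, add_comm] using hN⟩
  have hbd : ∀ a N, algebraMap ℝ R N - a ∈ Q → ∀ r ∈ S a, r ≤ N := by
    intro a N hN r hr
    have := hq.add_mem hN hr
    rw [sub_add_sub_cancel, ← map_sub] at this
    linarith [hproper _ this]
  have hbdd : ∀ a, BddAbove (S a) := fun a =>
    let ⟨N, hN⟩ := harch a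
    ⟨N, hbd a N hN⟩
  let φ : R → ℝ := fun a => sSup (S a)
  have hle : ∀ a r, a - algebraMap ℝ R r ∈ Q → r ≤ φ a := fun a r h => le_csSup (hbdd a) h
  have hge : ∀ a r, algebraMap ℝ R r - a ∈ Q → φ a ≤ r := fun a r h => csSup_le (hne a) (hbd a r h)
  have hlt : ∀ a r, r < φ a → a - algebraMap ℝ R r ∈ Q := by
    intro a r h
    rcases mem_or_neg_mem_of_maximal hQ (a - algebraMap ℝ R r) with h' | h'
    · exact h'
    · exact absurd (hge a r (by simpa using h')) h.not_ge
  have hgt : ∀ a r, φ a < r → algebraMap ℝ R r - a ∈ Q := by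
    intro a r h
    rcases mem_or_neg_mem_of_maximal hQ (algebraMap ℝ R r - a) with h' | h'
    · exact h'
    · exact absurd (hle a r (by simpa using h')) h.not_ge
  have hC : ∀ r, φ (algebraMap ℝ R r) = r := fun r =>
    le_antisymm (hge _ _ (by simpa using hq.zero_mem)) (hle _ _ (by simpa using hq.zero_mem))
  have hadd : ∀ a b, φ (a + b) = φ a + φ b := by
    intro a b
    apply le_antisymm
    · refine le_of_forall_pos_le_add fun ε hε => ?_
      refine hge _ _ ?_
      convert hq.add_mem (hgt a (φ a + ε / 2) (by linarith)) (hgt b (φ b + ε / 2) (by linarith))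
        using 1
      rw [show φ a + φ b + ε = (φ a + ε / 2) + (φ b + ε / 2) by ring, map_add]
      ring
    · refine le_of_forall_pos_sub_le fun ε hε => ?_
      refine hle _ _ ?_
      convert hq.add_mem (hlt a (φ a - ε / 2) (by linarith)) (hlt b (φ b - ε / 2) (by linarith))
        using 1
      rw [show φ a + φ b - ε = (φ a - ε / 2) + (φ b - ε / 2) by ring, map_add]
      ring
  have hnonneg : ∀ a ∈ Q, 0 ≤ φ a := fun a ha => hle a 0 (by simpa using ha)
  -- If `φ a = 0`, then `-√ε ≤ a ≤ √ε` modulo `Q`, hence `a² ≤ ε`. Applied to `a - φ a` this gives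
  -- `φ (a²) = (φ a)²`, and polarization then gives multiplicativity.
  have hsq0 : ∀ a, φ a = 0 → φ (a ^ 2) = 0 := by
    intro a ha
    refine le_antisymm ?_ (hnonneg _ (hq.sq_mem a))
    refine le_of_forall_pos_le_add fun ε hε => ?_
    refine hge _ _ ?_
    have hs : 0 < √ε := Real.sqrt_pos.2 hε
    have := hq.sq_sub_sq_mem hs (hgt a _ (by linarith))
      (by simpa [add_comm] using hlt a (-√ε) (by linarith))
    simpa [← map_pow, Real.sq_sqrt hε.le] using this
  have hzero : φ 0 = 0 := by simpa using hC 0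
  have hone : φ 1 = 1 := by simpa using hC 1
  let ψ : R →+ ℝ := ⟨⟨φ, hzero⟩, hadd⟩
  have hneg : ∀ a, φ (-a) = -φ a := ψ.map_neg
  have hsub : ∀ a b, φ (a - b) = φ a - φ b := ψ.map_sub
  have hsmul_ge : ∀ r : ℝ, 0 < r → ∀ a, r * φ a ≤ φ (r • a) := by
    intro r hr a
    rw [← le_div_iff₀' hr]
    refine le_of_forall_lt fun t ht => ?_
    obtain ⟨u, htu, hu⟩ := exists_between ht
    refine htu.trans_le ?_
    rw [le_div_iff₀' hr]
    refine hle _ _ ?_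
    convert hq.smul_mem hr.le (hlt a u hu) using 1
    rw [smul_sub, map_mul, ← Algebra.smul_def]
  have hsmul_pos : ∀ r : ℝ, 0 < r → ∀ a, φ (r • a) = r * φ a := by
    intro r hr a
    refine le_antisymm ?_ (hsmul_ge r hr a)
    have := hsmul_ge r hr (-a)
    rw [smul_neg, hneg, hneg] at this
    linarith
  have hsmul : ∀ (r : ℝ) a, φ (r • a) = r * φ a := by
    intro r a
    rcases lt_trichotomy r 0 with hr | rfl | hr
    · have := hsmul_pos (-r) (neg_pos.2 hr) a
      rw [neg_smul, hneg] at this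
      linarith
    · simpa using hzero
    · exact hsmul_pos r hr a
  have hsq : ∀ a, φ (a ^ 2) = φ a ^ 2 := by
    intro a
    have h := hsq0 (a - algebraMap ℝ R (φ a)) (by rw [hsub, hC, sub_self])
    have e : (a - algebraMap ℝ R (φ a)) ^ 2
        = a ^ 2 - (2 * φ a) • a + algebraMap ℝ R (φ a ^ 2) := by
      rw [Algebra.smul_def, map_mul, map_pow, map_ofNat]
      ring
    rw [e, hadd, hsub, hsmul, hC] at h
    linarith
  have hmul : ∀ a b, φ (a * b) = φ a * φ b := by
    intro a b
    have h := hsq (a + b)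
    rw [show (a + b) ^ 2 = a ^ 2 + b ^ 2 + (a * b + a * b) by ring] at h
    simp only [hadd, hsq] at h
    linarith
  exact ⟨⟨⟨⟨⟨φ, hone⟩, hmul⟩, hzero, hadd⟩, hC⟩, hnonneg⟩

/-- The Positivstellensatz of Putinar and Jacobi: an element that is positive at all real
characters nonnegative on an archimedean quadratic module belongs to the module. -/
theorem mem_of_forall_algHom_pos (hM : IsQuadModule M) (harch : IsArchimedean M) {f : R}
    (hf : ∀ φ : R →ₐ[ℝ] ℝ, (∀ a ∈ M, 0 ≤ φ a) → 0 < φ f) : f ∈ M := by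
  have hM' := hM.adjoin (-f)
  have hsub : M ⊆ {p | ∃ m ∈ M, ∃ s, IsSumSq s ∧ p = m + -f * s} :=
    fun m hm => ⟨m, hm, 0, .zero, by simp⟩
  -- Otherwise a maximal module containing `M` and `-f` would yield a character with `φ f ≤ 0`.
  have hone : (-1 : R) ∈ {p | ∃ m ∈ M, ∃ s, IsSumSq s ∧ p = m + -f * s} := by
    by_contra hcon
    obtain ⟨Q, hMQ, hQ⟩ := hM'.exists_maximal hcon
    obtain ⟨φ, hφ⟩ := exists_algHom_of_maximal hQ fun a =>
      let ⟨N, hN⟩ := harch a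
      ⟨N, hMQ (hsub hN)⟩
    have h₁ := hf φ fun a ha => hφ a (hMQ (hsub ha))
    have h₂ := hφ (-f) (hMQ ⟨0, hM.zero_mem, 1, IsSumSq.one, by simp⟩)
    rw [map_neg] at h₂
    linarith
  obtain ⟨m, hm, s, hs, e⟩ := hone
  have hsf : s * f - 1 ∈ M := by
    convert hm using 1
    linear_combination e
  obtain ⟨N₁, hN₁⟩ := harch s
  obtain ⟨N₂, hN₂⟩ := harch (s ^ 2 * f)
  obtain ⟨N₃, hN₃⟩ := harch (-f)
  obtain ⟨k, hk, hk₁, hk₂⟩ : ∃ k : ℝ, 0 < k ∧ N₁ ≤ 2 * k ∧ N₂ ≤ 2 * k - 1 :=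
    ⟨|N₁| + |N₂| + 1, by positivity, by linarith [le_abs_self N₁, abs_nonneg N₁, abs_nonneg N₂],
      by linarith [le_abs_self N₂, abs_nonneg N₁, abs_nonneg N₂]⟩
  have hmono : ∀ {N N' : ℝ} {a : R}, N ≤ N' → algebraMap ℝ R N - a ∈ M →
      algebraMap ℝ R N' - a ∈ M := by
    intro N N' a hle h
    convert hM.add_mem h (hM.algebraMap_mem (sub_nonneg.2 hle)) using 1
    rw [map_sub]
    ring
  have h₁ := hmono hk₁ hN₁
  have h₂ := hmono hk₂ hN₂
  -- `2k · s(2k - s) = s²(2k - s) + (2k - s)² s`.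
  have hs' : s * (algebraMap ℝ R (2 * k) - s) ∈ M := by
    refine hM.of_smul_mem (r := 2 * k) (by positivity) ?_
    convert hM.add_mem (hM.sq_mul_mem s h₁)
      (hM.sq_mul_mem (algebraMap ℝ R (2 * k) - s) (hM.sumSq_mem hs)) using 1
    rw [Algebra.smul_def]
    ring
  -- `k²(f + r) - 1 = (k - s)²(f + r) + 2k(sf - 1) + r s(2k - s) + (2k - 1 - s²f)`, which explains
  -- the two bounds imposed on `k`. The decrement `k⁻²` does not depend on `r`, so finitely many
  -- steps bring the constant down to `0`.
  have step : ∀ r : ℝ, 0 ≤ r → f + algebraMap ℝ R r ∈ M →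
      f + algebraMap ℝ R (r - (k ^ 2)⁻¹) ∈ M := by
    intro r hr h
    refine hM.of_smul_mem (r := k ^ 2) (by positivity) ?_
    have h₃ := hM.smul_mem (r := 2 * k) (by positivity) hsf
    have h₄ := hM.smul_mem hr hs'
    convert hM.add_mem (hM.add_mem (hM.add_mem (hM.sq_mul_mem (algebraMap ℝ R k - s) h) h₃) h₄) h₂
      using 1
    have e₁ : algebraMap ℝ R k ^ 2 * algebraMap ℝ R (k ^ 2)⁻¹ = 1 := by
      rw [← map_pow, ← map_mul, mul_inv_cancel₀ (by positivity), map_one]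
    simp only [Algebra.smul_def, map_sub, map_mul, map_pow, map_ofNat, map_one] at e₁ ⊢
    linear_combination -e₁
  -- The truncation at `0` keeps the constant in the range `0 ≤ r` that `step` requires.
  have descend : ∀ j : ℕ, f + algebraMap ℝ R (max (N₃ - j * (k ^ 2)⁻¹) 0) ∈ M := by
    intro j
    induction j with
    | zero =>
      have := hmono (le_max_left N₃ 0) hN₃
      simpa [add_comm] using this
    | succ j ih =>
      have h := step _ (le_max_right _ _) ih
      have h' := hmono (a := -f) (N := max (N₃ - j * (k ^ 2)⁻¹) 0 - (k ^ 2)⁻¹)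
        (N' := max (N₃ - (j + 1 : ℕ) * (k ^ 2)⁻¹) 0) ?_ (by simpa [add_comm] using h)
      · simpa [add_comm] using h'
      · have : 0 < (k ^ 2)⁻¹ := by positivity
        push_cast
        rcases max_cases (N₃ - j * (k ^ 2)⁻¹) 0 with ⟨hx, -⟩ | ⟨hx, -⟩ <;> rw [hx]
        · exact le_trans (by linarith) (le_max_left _ _)
        · exact le_trans (by linarith) (le_max_right _ _)
  obtain ⟨j, hj⟩ := exists_nat_gt (N₃ * k ^ 2)
  have := descend j
  rwa [max_eq_right, map_zero, add_zero] at this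
  rw [sub_nonpos, ← div_eq_mul_inv, le_div_iff₀ (by positivity)]
  exact hj.le

end Algebra

end IsQuadModule


/-! ### Putinar's theorem for polynomials on subsets of the sphere. -/

/-- Over a polynomial ring, a quadratic module bounding every variable is archimedean. -/
theorem IsQuadModule.isArchimedean_of_one_sub_X_sq {σ : Type*} {M : Set (MvPolynomial σ ℝ)}
    (hM : IsQuadModule M) (hX : ∀ i, 1 - MvPolynomial.X i ^ 2 ∈ M) : IsArchimedean M := by
  have hmono : ∀ {N N' : ℝ} {a : MvPolynomial σ ℝ}, N ≤ N' → algebraMap ℝ _ N - a ∈ M →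
      algebraMap ℝ _ N' - a ∈ M := by
    intro N N' a hle h
    convert hM.add_mem h (hM.algebraMap_mem (sub_nonneg.2 hle)) using 1
    rw [map_sub]
    ring
  -- Two-sided boundedness, unlike an upper bound alone, is stable under negation and products.
  -- Products come from `4ab = (a + b)² - (a - b)²`.
  let B : MvPolynomial σ ℝ → Prop := fun a =>
    ∃ N : ℝ, algebraMap ℝ _ N - a ∈ M ∧ algebraMap ℝ _ N - -a ∈ M
  have hC : ∀ r : ℝ, B (MvPolynomial.C r) := by
    intro r
    refine ⟨|r|, ?_, ?_⟩
    · rw [← MvPolynomial.algebraMap_eq, ← map_sub]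
      exact hM.algebraMap_mem (by linarith [le_abs_self r])
    · rw [← MvPolynomial.algebraMap_eq, ← map_neg, ← map_sub]
      exact hM.algebraMap_mem (by linarith [neg_abs_le r])
  have hadd : ∀ a b, B a → B b → B (a + b) := by
    rintro a b ⟨N, h₁, h₂⟩ ⟨N', h₁', h₂'⟩
    refine ⟨N + N', ?_, ?_⟩
    · convert hM.add_mem h₁ h₁' using 1
      rw [map_add]
      ring
    · convert hM.add_mem h₂ h₂' using 1
      rw [map_add]
      ring
  have hneg : ∀ a, B a → B (-a) := by
    rintro a ⟨N, h₁, h₂⟩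
    exact ⟨N, h₂, by rwa [neg_neg]⟩
  have hsq : ∀ a, B a → B (a ^ 2) := by
    rintro a ⟨N, h₁, h₂⟩
    have h₁' := hmono ((le_abs_self N).trans (lt_add_one _).le) h₁
    have h₂' := hmono ((le_abs_self N).trans (lt_add_one _).le) h₂
    rw [sub_neg_eq_add] at h₂'
    refine ⟨(|N| + 1) ^ 2, hM.sq_sub_sq_mem (by positivity) h₁' h₂', ?_⟩
    rw [sub_neg_eq_add]
    exact hM.add_mem (hM.algebraMap_mem (by positivity)) (hM.sq_mem a)
  have hsmul : ∀ r : ℝ, 0 ≤ r → ∀ a, B a → B (r • a) := by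
    rintro r hr a ⟨N, h₁, h₂⟩
    refine ⟨r * N, ?_, ?_⟩
    · convert hM.smul_mem hr h₁ using 1
      rw [smul_sub, map_mul, ← Algebra.smul_def]
    · convert hM.smul_mem hr h₂ using 1
      rw [smul_sub, smul_neg, map_mul, ← Algebra.smul_def]
  have hmul : ∀ a b, B a → B b → B (a * b) := by
    intro a b ha hb
    have h := hsmul (1 / 4) (by norm_num) _
      (hadd _ _ (hsq _ (hadd _ _ ha hb)) (hneg _ (hsq _ (hadd _ _ ha (hneg _ hb)))))
    convert h using 1
    rw [show (a + b) ^ 2 + -(a + -b) ^ 2 = (4 : ℝ) • (a * b) by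
      rw [Algebra.smul_def, map_ofNat]
      ring, smul_smul]
    norm_num
  have hvar : ∀ i, B (MvPolynomial.X i) := by
    intro i
    refine ⟨1, ?_, ?_⟩
    -- `2(1 ∓ X) = (1 - X²) + (1 ∓ X)²`, with the other sign in the next case.
    · refine hM.of_smul_mem (r := 2) (by norm_num) ?_
      convert hM.add_mem (hX i) (hM.sq_mem (1 - MvPolynomial.X i)) using 1
      rw [Algebra.smul_def, map_ofNat, map_one]
      ring
    · refine hM.of_smul_mem (r := 2) (by norm_num) ?_
      convert hM.add_mem (hX i) (hM.sq_mem (1 + MvPolynomial.X i)) using 1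
      rw [Algebra.smul_def, map_ofNat, map_one]
      ring
  intro a
  have : B a := by
    induction a using MvPolynomial.induction_on with
    | C r => exact hC r
    | add p q hp hq => exact hadd p q hp hq
    | mul_X p i hp => exact hmul p _ hp (hvar i)
  exact ⟨this.choose, this.choose_spec.1⟩

section Putinar

variable {m : ℕ} {ι κ : Type*} [Fintype κ]

theorem isQuadModule_ideal_add_qmod (J : Ideal (MvPolynomial (Fin m) ℝ))
    (g : κ → MvPolynomial (Fin m) ℝ) :
    IsQuadModule ((J : Set (MvPolynomial (Fin m) ℝ)) + qmod g) where
  one_mem := Set.mem_add.2 ⟨0, J.zero_mem, 1, ⟨1, 0, .one, fun _ => .zero, by simp⟩, zero_add 1⟩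
  add_mem := by
    intro a b ha hb
    obtain ⟨j, hj, _, ⟨σ₀, σ, h₀, h, rfl⟩, rfl⟩ := Set.mem_add.1 ha
    obtain ⟨j', hj', _, ⟨τ₀, τ, k₀, k, rfl⟩, rfl⟩ := Set.mem_add.1 hb
    refine Set.mem_add.2 ⟨j + j', J.add_mem hj hj', _,
      ⟨σ₀ + τ₀, σ + τ, h₀.add k₀, fun i => (h i).add (k i), rfl⟩, ?_⟩
    simp only [Pi.add_apply, mul_add, Finset.sum_add_distrib]
    ring
  sq_mul_mem := by
    intro c a ha
    obtain ⟨j, hj, _, ⟨σ₀, σ, h₀, h, rfl⟩, rfl⟩ := Set.mem_add.1 ha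
    have hc : IsSumSq (c ^ 2) := by simp [pow_two]
    refine Set.mem_add.2 ⟨c ^ 2 * j, J.mul_mem_left _ hj, _,
      ⟨c ^ 2 * σ₀, fun i => c ^ 2 * σ i, hc.mul h₀, fun i => hc.mul (h i), rfl⟩, ?_⟩
    simp only [mul_add, Finset.mul_sum, mul_left_comm]

theorem ideal_subset_ideal_add_qmod (J : Ideal (MvPolynomial (Fin m) ℝ))
    (g : κ → MvPolynomial (Fin m) ℝ) {p : MvPolynomial (Fin m) ℝ} (hp : p ∈ J) :
    p ∈ (J : Set (MvPolynomial (Fin m) ℝ)) + qmod g :=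
  Set.mem_add.2 ⟨p, hp, 0, ⟨0, 0, .zero, fun _ => .zero, by simp⟩, add_zero p⟩

theorem gen_mem_ideal_add_qmod (J : Ideal (MvPolynomial (Fin m) ℝ))
    (g : κ → MvPolynomial (Fin m) ℝ) (j : κ) :
    g j ∈ (J : Set (MvPolynomial (Fin m) ℝ)) + qmod g := by
  classical
  refine Set.mem_add.2 ⟨0, J.zero_mem, g j, ⟨0, Pi.single j 1, .zero, fun i => ?_, ?_⟩, zero_add _⟩
  · rcases eq_or_ne i j with rfl | hij
    · simp
    · simp [hij]
  · simp [Pi.single_apply]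

theorem _root_.IsSumSq.eval_nonneg {σ : Type*} {s : MvPolynomial σ ℝ} (hs : IsSumSq s)
    (z : σ → ℝ) : 0 ≤ MvPolynomial.eval z s := by
  induction hs with
  | zero => simp
  | sq_add c _ ih =>
    rw [map_add, map_mul]
    exact add_nonneg (mul_self_nonneg _) ih

theorem eval_nonneg_of_mem_ideal_add_qmod {h : ι → MvPolynomial (Fin m) ℝ}
    {g : κ → MvPolynomial (Fin m) ℝ} {p : MvPolynomial (Fin m) ℝ}
    (hp : p ∈ (idealOf h : Set (MvPolynomial (Fin m) ℝ)) + qmod g) {z : Fin m → ℝ}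
    (hz : z ∈ semialgSet h g) : 0 ≤ MvPolynomial.eval z p := by
  obtain ⟨j, hj, _, ⟨σ₀, σ, h₀, hσ, rfl⟩, rfl⟩ := Set.mem_add.1 hp
  have hj' : j ∈ RingHom.ker (MvPolynomial.eval z) := by
    refine (Ideal.span_le.2 ?_) hj
    rintro _ ⟨i, rfl⟩
    exact hz.1 i
  rw [map_add, (RingHom.mem_ker).1 hj', zero_add, map_add, map_sum]
  refine add_nonneg (h₀.eval_nonneg z) (Finset.sum_nonneg fun i _ => ?_)
  rw [map_mul]
  exact mul_nonneg (hz.2 i) ((hσ i).eval_nonneg z)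

/-- Putinar's Positivstellensatz for a set contained in the unit sphere. -/
theorem mem_ideal_add_qmod_of_pos {h : ι → MvPolynomial (Fin m) ℝ}
    {g : κ → MvPolynomial (Fin m) ℝ}
    (hsphere : ∑ i, MvPolynomial.X i ^ 2 - 1 ∈ idealOf h) {p : MvPolynomial (Fin m) ℝ}
    (hp : ∀ z ∈ semialgSet h g, 0 < MvPolynomial.eval z p) :
    p ∈ (idealOf h : Set (MvPolynomial (Fin m) ℝ)) + qmod g := by
  have hM := isQuadModule_ideal_add_qmod (idealOf h) g
  refine hM.mem_of_forall_algHom_pos (hM.isArchimedean_of_one_sub_X_sq fun i => ?_) ?_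
  -- `1 - X_i²` is minus the sphere equation plus the squares of the other variables.
  · have h₁ := ideal_subset_ideal_add_qmod (idealOf h) g ((idealOf h).neg_mem hsphere)
    have h₂ := hM.sum_mem (Finset.univ.erase i)
      fun j _ => hM.sq_mem (MvPolynomial.X j : MvPolynomial (Fin m) ℝ)
    convert hM.add_mem h₁ h₂ using 1
    rw [← Finset.add_sum_erase _ _ (Finset.mem_univ i)]
    ring
  · intro φ hφ
    have hev : ∀ q, φ q = MvPolynomial.eval (fun i => φ (MvPolynomial.X i)) q := by
      intro q
      have : φ = MvPolynomial.aeval fun i => φ (MvPolynomial.X i) :=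
        MvPolynomial.algHom_ext (by simp)
      conv_lhs => rw [this]
      rw [MvPolynomial.aeval_eq_eval]
    rw [hev]
    refine hp _ ⟨fun i => ?_, fun j => ?_⟩
    · rw [← hev]
      have hi : h i ∈ idealOf h := Ideal.subset_span ⟨i, rfl⟩
      have h₁ := hφ _ (ideal_subset_ideal_add_qmod _ g hi)
      have h₂ := hφ _ (ideal_subset_ideal_add_qmod _ g ((idealOf h).neg_mem hi))
      rw [map_neg] at h₂
      linarith
    · rw [← hev]
      exact hφ _ (gen_mem_ideal_add_qmod _ g j)

end Putinar


/-! ### Homogenization and positivity at infinity. -/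

section Homogenize

variable {n : ℕ}

/-- Homogenization `p ↦ x₀^d p(x/x₀)` of polynomials of degree at most `d`, as a linear map. -/
noncomputable def homogenizeAt (d : ℕ) :
    MvPolynomial (Fin n) ℝ →ₗ[ℝ] MvPolynomial (Fin (n + 1)) ℝ :=
  (MvPolynomial.basisMonomials (Fin n) ℝ).constr ℝ fun α =>
    MvPolynomial.monomial (Finsupp.cons (d - α.degree) α) 1

theorem homogenizeAt_monomial (d : ℕ) (α : Fin n →₀ ℕ) (c : ℝ) :
    homogenizeAt d (MvPolynomial.monomial α c) =
      MvPolynomial.monomial (Finsupp.cons (d - α.degree) α) c := by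
  have h := (MvPolynomial.basisMonomials (Fin n) ℝ).constr_basis ℝ (fun α =>
    (MvPolynomial.monomial (Finsupp.cons (d - α.degree) α) 1 : MvPolynomial (Fin (n + 1)) ℝ)) α
  rw [MvPolynomial.coe_basisMonomials] at h
  rw [show MvPolynomial.monomial α c = c • MvPolynomial.monomial α (1 : ℝ) by
    rw [MvPolynomial.smul_monomial, smul_eq_mul, mul_one], map_smul, homogenizeAt, h,
    MvPolynomial.smul_monomial, smul_eq_mul, mul_one]

theorem homogenization_eq_homogenizeAt (p : MvPolynomial (Fin n) ℝ) :
    homogenization p = homogenizeAt p.totalDegree p := by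
  conv_rhs => rw [p.as_sum, map_sum]
  rw [← p.as_sum]
  exact Finset.sum_congr rfl fun α _ => (homogenizeAt_monomial _ _ _).symm

theorem cons_injective (d : ℕ) :
    Function.Injective fun α : Fin n →₀ ℕ => Finsupp.cons (d - α.degree) α :=
  Function.LeftInverse.injective (g := Finsupp.tail) fun α => Finsupp.tail_cons _ α

/-- Homogenizing only relabels exponents, and the tail recovers `α`. No degree bound is needed:
truncation in `d - |α|` cannot merge two monomials. -/
theorem coeff_homogenizeAt (d : ℕ) (α : Fin n →₀ ℕ) (p : MvPolynomial (Fin n) ℝ) :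
    MvPolynomial.coeff (Finsupp.cons (d - α.degree) α) (homogenizeAt d p) =
      MvPolynomial.coeff α p := by
  classical
  induction p using MvPolynomial.induction_on' with
  | monomial β c =>
    rw [homogenizeAt_monomial, MvPolynomial.coeff_monomial, MvPolynomial.coeff_monomial]
    exact if_congr (cons_injective d).eq_iff rfl rfl
  | add p q hp hq => rw [map_add, MvPolynomial.coeff_add, MvPolynomial.coeff_add, hp, hq]

theorem eval_homogenizeAt_monomial {d : ℕ} {α : Fin n →₀ ℕ} (hα : α.degree ≤ d) (c : ℝ)
    {z : Fin (n + 1) → ℝ} (hz : z 0 ≠ 0) :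
    MvPolynomial.eval z (homogenizeAt d (MvPolynomial.monomial α c)) =
      z 0 ^ d * MvPolynomial.eval (fun i => z i.succ / z 0) (MvPolynomial.monomial α c) := by
  rw [homogenizeAt_monomial, MvPolynomial.eval_monomial, MvPolynomial.eval_monomial,
    Finsupp.prod_fintype _ _ (by simp), Finsupp.prod_fintype _ _ (by simp), Fin.prod_univ_succ]
  simp only [Finsupp.cons_zero, Finsupp.cons_succ, div_pow, Finset.prod_div_distrib,
    Finset.prod_pow_eq_pow_sum, ← Finsupp.degree_eq_sum]
  rw [← Nat.sub_add_cancel hα, pow_add, Nat.add_sub_cancel]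
  field_simp

theorem mem_polySpace {A : Finset (Fin n →₀ ℕ)} {p : MvPolynomial (Fin n) ℝ} :
    p ∈ polySpace A ↔ p.support ⊆ A := by
  rw [polySpace, MvPolynomial.mem_restrictSupport_iff, Finset.coe_subset]

theorem monomial_mem_polySpace {A : Finset (Fin n →₀ ℕ)} {α : Fin n →₀ ℕ} (hα : α ∈ A) (c : ℝ) :
    MvPolynomial.monomial α c ∈ polySpace A :=
  mem_polySpace.2 (MvPolynomial.support_monomial_subset.trans (by simpa using hα))

theorem sum_monomial_coeff {A : Finset (Fin n →₀ ℕ)} {p : MvPolynomial (Fin n) ℝ}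
    (hp : p ∈ polySpace A) : ∑ α ∈ A, MvPolynomial.monomial α (MvPolynomial.coeff α p) = p := by
  conv_rhs => rw [p.as_sum]
  refine (Finset.sum_subset (mem_polySpace.1 hp) fun α _ hα => ?_).symm
  rw [MvPolynomial.notMem_support_iff.1 hα, MvPolynomial.monomial_zero]

theorem coeffVec_injOn {A : Finset (Fin n →₀ ℕ)} :
    Set.InjOn (coeffVec A) (polySpace A : Set (MvPolynomial (Fin n) ℝ)) := by
  intro p hp q hq h
  rw [← sum_monomial_coeff hp, ← sum_monomial_coeff hq]
  exact Finset.sum_congr rfl fun α hα => congrArg _ (congrFun h ⟨α, hα⟩)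

theorem polySpace_le_expLE (A : Finset (Fin n →₀ ℕ)) :
    polySpace A ≤ polySpace (expLE n (expDeg A)) :=
  MvPolynomial.restrictSupport_mono ℝ fun _ hα =>
    mem_expLE.2 (Finset.le_sup (f := fun α : Fin n →₀ ℕ => α.degree) hα)

theorem mem_polySpace_expLE_totalDegree (p : MvPolynomial (Fin n) ℝ) :
    p ∈ polySpace (expLE n p.totalDegree) :=
  mem_polySpace.2 fun _ hα => mem_expLE.2 (MvPolynomial.le_totalDegree hα)

theorem eval_homogenizeAt {d : ℕ} {p : MvPolynomial (Fin n) ℝ} (hp : p ∈ polySpace (expLE n d))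
    {z : Fin (n + 1) → ℝ} (hz : z 0 ≠ 0) :
    MvPolynomial.eval z (homogenizeAt d p) =
      z 0 ^ d * MvPolynomial.eval (fun i => z i.succ / z 0) p := by
  rw [← sum_monomial_coeff hp]
  simp only [map_sum, Finset.mul_sum]
  exact Finset.sum_congr rfl fun α hα => eval_homogenizeAt_monomial (mem_expLE.1 hα) _ hz

theorem eval_homogenization (p : MvPolynomial (Fin n) ℝ) {z : Fin (n + 1) → ℝ} (hz : z 0 ≠ 0) :
    MvPolynomial.eval z (homogenization p) =
      z 0 ^ p.totalDegree * MvPolynomial.eval (fun i => z i.succ / z 0) p := by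
  rw [homogenization_eq_homogenizeAt, eval_homogenizeAt (mem_polySpace_expLE_totalDegree p) hz]

/-- For `x₀ > 0`, each homogenized constraint is the original one at `x / x₀` times a positive power
of `x₀`, so signs and zeros agree. -/
theorem mem_homCone_iff {E I : Type*} {cE : E → MvPolynomial (Fin n) ℝ}
    {cI : I → MvPolynomial (Fin n) ℝ} {z : Fin (n + 1) → ℝ} (hz : 0 < z 0) :
    z ∈ homCone cE cI ↔ (fun i => z i.succ / z 0) ∈ semialgSet cE cI := by
  have hpow : ∀ k, 0 < z 0 ^ k := fun k => pow_pos hz k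
  simp only [homCone, semialgSet, Set.mem_ofPred_eq, eval_homogenization _ hz.ne', hz.le, and_true,
    mul_eq_zero, (hpow _).ne', false_or, mul_nonneg_iff_of_pos_left (hpow _)]

/-- Nonnegativity on `K` passes to nonnegativity of the homogenization on `K̃^h`. -/
theorem eval_homogenizeAt_nonneg {E I : Type*} {cE : E → MvPolynomial (Fin n) ℝ}
    {cI : I → MvPolynomial (Fin n) ℝ} (hK : ClosedAtInfinity cE cI) {d : ℕ}
    {p : MvPolynomial (Fin n) ℝ} (hp : p ∈ nonnegCone (expLE n d) (semialgSet cE cI))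
    {z : Fin (n + 1) → ℝ} (hz : z ∈ homCone cE cI) :
    0 ≤ MvPolynomial.eval z (homogenizeAt d p) := by
  rw [← hK] at hz
  have hclosed : IsClosed {z : Fin (n + 1) → ℝ | 0 ≤ MvPolynomial.eval z (homogenizeAt d p)} :=
    isClosed_le continuous_const (MvPolynomial.continuous_eval _)
  refine closure_minimal ?_ hclosed hz
  rintro w ⟨hw, hw0 : 0 < w 0⟩
  rw [Set.mem_ofPred_eq, eval_homogenizeAt hp.1 hw0.ne']
  exact mul_nonneg (pow_pos hw0 d).le (hp.2 _ ((mem_homCone_iff hw0).1 hw))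

theorem homogenizeAt_mem_polySpace {A : Finset (Fin n →₀ ℕ)} {p : MvPolynomial (Fin n) ℝ}
    (hp : p ∈ polySpace A) : homogenizeAt (expDeg A) p ∈ polySpace (expTilde A) := by
  rw [← sum_monomial_coeff hp, map_sum]
  refine Submodule.sum_mem _ fun α hα => ?_
  rw [homogenizeAt_monomial]
  exact monomial_mem_polySpace (Finset.mem_image_of_mem _ hα) _

theorem exists_homogenizeAt_eq {A : Finset (Fin n →₀ ℕ)} {q : MvPolynomial (Fin (n + 1)) ℝ}
    (hq : q ∈ polySpace (expTilde A)) : ∃ p ∈ polySpace A, homogenizeAt (expDeg A) p = q := by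
  refine ⟨∑ α ∈ A, MvPolynomial.monomial α
    (MvPolynomial.coeff (Finsupp.cons (expDeg A - α.degree) α) q),
    Submodule.sum_mem _ fun α hα => monomial_mem_polySpace hα _, ?_⟩
  rw [map_sum]
  conv_rhs => rw [← sum_monomial_coeff hq]
  rw [expTilde, Finset.sum_image (cons_injective _).injOn]
  exact Finset.sum_congr rfl fun α _ => homogenizeAt_monomial _ _ _

theorem riesz_homogenizeAt {A : Finset (Fin n →₀ ℕ)} (y : A → ℝ) (p : MvPolynomial (Fin n) ℝ) :
    riesz (expTilde A) (tmsTilde y) (homogenizeAt (expDeg A) p) = riesz A y p := by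
  refine (Fintype.sum_bijective
    (fun α : A => (⟨_, Finset.mem_image_of_mem _ α.2⟩ : expTilde A)) ⟨?_, ?_⟩ _ _ ?_).symm
  · intro α β h
    exact Subtype.ext (cons_injective _ (congrArg Subtype.val h))
  · rintro ⟨β, hβ⟩
    obtain ⟨α, hα, rfl⟩ := Finset.mem_image.1 hβ
    exact ⟨⟨α, hα⟩, rfl⟩
  · intro α
    simp only [coeff_homogenizeAt, tmsTilde, Finsupp.tail_cons]

/-- The homogenization of an interior point of `P_d(K)` is positive on `K̃^h` off the origin. -/
theorem eval_homogenizeAt_pos {E I : Type*} {cE : E → MvPolynomial (Fin n) ℝ}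
    {cI : I → MvPolynomial (Fin n) ℝ} (hK : ClosedAtInfinity cE cI) {d : ℕ}
    {f : MvPolynomial (Fin n) ℝ}
    (hf : f ∈ polyInterior (expLE n d) (nonnegCone (expLE n d) (semialgSet cE cI)))
    {z : Fin (n + 1) → ℝ} (hz : z ∈ homCone cE cI) (hz0 : z ≠ 0) :
    0 < MvPolynomial.eval z (homogenizeAt d f) := by
  obtain ⟨i, hi⟩ := Function.ne_iff.1 hz0
  -- The monomial whose homogenization is the `d`-th power of a nonzero coordinate of `z`: `1` for
  -- `x₀`, and `x_j^d` for `x_j`.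
  obtain ⟨α, hα, hev⟩ : ∃ α : Fin n →₀ ℕ, α.degree ≤ d ∧ ∀ c : ℝ,
      MvPolynomial.eval z (homogenizeAt d (MvPolynomial.monomial α c)) = c * z i ^ d := by
    refine Fin.cases ⟨0, by simp, fun c => ?_⟩
      (fun j => ⟨Finsupp.single j d, by simp [Finsupp.degree_single], fun c => ?_⟩) i
    · rw [homogenizeAt_monomial, map_zero, Finsupp.cons_zero_eq_single_zero,
        MvPolynomial.eval_monomial, Finsupp.prod_single_index (by simp), Nat.sub_zero]
    · rw [homogenizeAt_monomial, Finsupp.degree_single, Nat.sub_self,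
        Finsupp.cons_zero_single_eq_single_succ, MvPolynomial.eval_monomial,
        Finsupp.prod_single_index (by simp)]
  have hmem : ∀ᶠ t in nhds (0 : ℝ),
      f + MvPolynomial.monomial α t ∈ nonnegCone (expLE n d) (semialgSet cE cI) := by
    have hcont : Continuous fun t : ℝ =>
        coeffVec (expLE n d) (f + MvPolynomial.monomial α t) := by
      classical
      refine continuous_pi fun β => ?_
      simp only [coeffVec, MvPolynomial.coeff_add, MvPolynomial.coeff_monomial]
      split_ifs <;> fun_prop
    have h0 : coeffVec (expLE n d) (f + MvPolynomial.monomial α (0 : ℝ)) ∈ interior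
        (coeffVec (expLE n d) '' nonnegCone (expLE n d) (semialgSet cE cI)) := by
      simpa using hf.2
    filter_upwards [hcont.continuousAt.preimage_mem_nhds (isOpen_interior.mem_nhds h0)] with t ht
    obtain ⟨g, hg, hgt⟩ := interior_subset ht
    have hft : f + MvPolynomial.monomial α t ∈ polySpace (expLE n d) :=
      Submodule.add_mem _ hf.1 (monomial_mem_polySpace (mem_expLE.2 hα) t)
    rwa [← coeffVec_injOn hg.1 hft hgt]
  have hmem' : ∀ᶠ t in nhds (0 : ℝ),
      f + MvPolynomial.monomial α (-t) ∈ nonnegCone (expLE n d) (semialgSet cE cI) :=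
    (continuous_neg.tendsto' 0 0 neg_zero).eventually hmem
  -- Perturbing by both `t` and `-t` forces the value at `z` to be at least `|t z_i^d| > 0`,
  -- whatever the sign of `z_i^d`.
  obtain ⟨t, ⟨h₁, h₂⟩, ht : t ≠ 0⟩ :=
    ((Filter.Eventually.filter_mono nhdsWithin_le_nhds (hmem.and hmem')).and
      (self_mem_nhdsWithin : {(0 : ℝ)}ᶜ ∈ nhdsWithin (0 : ℝ) {0}ᶜ)).exists
  have e₁ := eval_homogenizeAt_nonneg hK h₁ hz
  have e₂ := eval_homogenizeAt_nonneg hK h₂ hz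
  rw [map_add, map_add, hev] at e₁ e₂
  have hne : t * z i ^ d ≠ 0 := mul_ne_zero ht (pow_ne_zero _ hi)
  rcases hne.lt_or_gt with h | h <;> linarith

end Homogenize

/-! ### The truncated moment cone and its dual description. -/

open MeasureTheory

section Moments

variable {n : ℕ} {A : Finset (Fin n →₀ ℕ)} {K : Set (Fin n → ℝ)}

theorem add_mem_momentCone {y z : A → ℝ} (hy : y ∈ momentCone A K) (hz : z ∈ momentCone A K) :
    y + z ∈ momentCone A K := by
  obtain ⟨μ, hμ, hμy⟩ := hy
  obtain ⟨ν, hν, hνz⟩ := hz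
  refine ⟨μ + ν, ?_, fun α => ⟨(hμy α).1.add_measure (hνz α).1, ?_⟩⟩
  · rw [Measure.support_add]
    exact Set.union_subset hμ hν
  · rw [integral_add_measure (hμy α).1 (hνz α).1, (hμy α).2, (hνz α).2, Pi.add_apply]

theorem smul_mem_momentCone {y : A → ℝ} (hy : y ∈ momentCone A K) {c : ℝ} (hc : 0 ≤ c) :
    c • y ∈ momentCone A K := by
  obtain ⟨μ, hμ, hμy⟩ := hy
  refine ⟨ENNReal.ofReal c • μ, ?_, fun α => ⟨(hμy α).1.smul_measure ENNReal.ofReal_ne_top, ?_⟩⟩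
  · exact (Measure.AbsolutelyContinuous.support_mono Measure.smul_absolutelyContinuous).trans hμ
  · rw [integral_smul_measure, (hμy α).2, ENNReal.toReal_ofReal hc, Pi.smul_apply]

theorem convex_momentCone : Convex ℝ (momentCone A K) := fun _ hy _ hz _ _ ha hb _ =>
  add_mem_momentCone (smul_mem_momentCone hy ha) (smul_mem_momentCone hz hb)

theorem zero_mem_momentCone : (0 : A → ℝ) ∈ momentCone A K :=
  ⟨0, by simp, fun α => by simp⟩

/-- The moments of the Dirac measure at a point of `K`. -/
theorem eval_mem_momentCone (hK : IsClosed K) {x : Fin n → ℝ} (hx : x ∈ K) :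
    (fun α : A => ∏ i, x i ^ (α : Fin n →₀ ℕ) i) ∈ momentCone A K := by
  refine ⟨Measure.dirac x, Measure.support_subset_of_isClosed hK ?_, fun α => ⟨?_, ?_⟩⟩
  · rw [mem_ae_dirac_iff hK.measurableSet]
    exact hx
  · exact integrable_dirac (by simp)
  · exact integral_dirac _ _

theorem isClosed_semialgSet {E I : Type*} (cE : E → MvPolynomial (Fin n) ℝ)
    (cI : I → MvPolynomial (Fin n) ℝ) : IsClosed (semialgSet cE cI) := by
  refine IsClosed.inter (s₁ := {x | ∀ i, MvPolynomial.eval x (cE i) = 0})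
    (s₂ := {x | ∀ j, 0 ≤ MvPolynomial.eval x (cI j)}) ?_ ?_
  · simp only [Set.ofPred_forall]
    exact isClosed_iInter fun i =>
      isClosed_eq (MvPolynomial.continuous_eval _) continuous_const
  · simp only [Set.ofPred_forall]
    exact isClosed_iInter fun j =>
      isClosed_le continuous_const (MvPolynomial.continuous_eval _)

theorem eval_eq_sum {p : MvPolynomial (Fin n) ℝ} (hp : p ∈ polySpace A) (x : Fin n → ℝ) :
    MvPolynomial.eval x p =
      ∑ α : A, MvPolynomial.coeff (α : Fin n →₀ ℕ) p * ∏ i, x i ^ (α : Fin n →₀ ℕ) i := by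
  conv_lhs => rw [← sum_monomial_coeff hp, map_sum, ← Finset.sum_coe_sort]
  refine Finset.sum_congr rfl fun α _ => ?_
  rw [MvPolynomial.eval_monomial, Finsupp.prod_fintype _ _ (by simp)]

/-- The Riesz functional of a moment sequence integrates polynomials. -/
theorem riesz_eq_integral {y : A → ℝ} {μ : Measure (Fin n → ℝ)} (hμ : IsRepresenting A K y μ)
    {p : MvPolynomial (Fin n) ℝ} (hp : p ∈ polySpace A) :
    riesz A y p = ∫ x, MvPolynomial.eval x p ∂μ := by
  simp only [eval_eq_sum hp]
  rw [integral_finsetSum _ fun α _ => (hμ.2 α).1.const_mul _]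
  simp only [integral_const_mul, (hμ.2 _).2, riesz]

theorem riesz_nonneg {y : A → ℝ} (hy : y ∈ momentCone A K) {p : MvPolynomial (Fin n) ℝ}
    (hp : p ∈ polySpace A) (hpK : ∀ x ∈ K, 0 ≤ MvPolynomial.eval x p) : 0 ≤ riesz A y p := by
  obtain ⟨μ, hμ⟩ := hy
  rw [riesz_eq_integral hμ hp]
  refine integral_nonneg_of_ae ?_
  filter_upwards [Measure.support_mem_ae (μ := μ)] with x hx using hpK x (hμ.1 hx)

theorem continuous_riesz (p : MvPolynomial (Fin n) ℝ) : Continuous fun y : A → ℝ => riesz A y p := by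
  unfold riesz
  fun_prop

theorem riesz_nonneg_of_mem_closure {y : A → ℝ} (hy : y ∈ closure (momentCone A K))
    {p : MvPolynomial (Fin n) ℝ} (hp : p ∈ polySpace A)
    (hpK : ∀ x ∈ K, 0 ≤ MvPolynomial.eval x p) : 0 ≤ riesz A y p :=
  closure_minimal (fun _ hz => riesz_nonneg hz hp hpK)
    (isClosed_le continuous_const (continuous_riesz p)) hy

/-- A point outside the closure of the moment cone is separated from it by a polynomial that is
nonnegative on `K`. -/
theorem exists_riesz_neg (hK : IsClosed K) {y : A → ℝ} (hy : y ∉ closure (momentCone A K)) :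
    ∃ p ∈ polySpace A, (∀ x ∈ K, 0 ≤ MvPolynomial.eval x p) ∧ riesz A y p < 0 := by
  classical
  obtain ⟨φ, u, hφy, hφ⟩ := geometric_hahn_banach_point_closed
    (convex_momentCone (A := A) (K := K)).closure isClosed_closure hy
  have hu : u < 0 := by simpa using hφ 0 (subset_closure zero_mem_momentCone)
  have hnonneg : ∀ z ∈ momentCone A K, 0 ≤ φ z := by
    intro z hz
    by_contra! hneg
    -- This nonnegative multiple of `z` stays in the cone, yet `φ` takes exactly the excluded value
    -- `u` on it.
    have h := hφ ((u / φ z) • z) (subset_closure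
      (smul_mem_momentCone hz (div_nonneg_of_nonpos hu.le hneg.le)))
    rw [map_smul, smul_eq_mul, div_mul_cancel₀ _ hneg.ne] at h
    exact h.false
  -- The coefficients are the coordinates of `φ`, so `φ` is the pairing with `p`; on Dirac moments
  -- it evaluates `p`.
  let p : MvPolynomial (Fin n) ℝ :=
    ∑ α : A, MvPolynomial.monomial (α : Fin n →₀ ℕ) (φ (Pi.single α 1))
  have hp : p ∈ polySpace A :=
    Submodule.sum_mem _ fun α _ => monomial_mem_polySpace α.2 _
  have hcoeff : ∀ α : A, MvPolynomial.coeff (α : Fin n →₀ ℕ) p = φ (Pi.single α 1) := by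
    intro α
    simp [p, MvPolynomial.coeff_sum, MvPolynomial.coeff_monomial]
  have hriesz : ∀ z : A → ℝ, ∑ α : A, MvPolynomial.coeff (α : Fin n →₀ ℕ) p * z α = φ z := by
    intro z
    conv_rhs => rw [pi_eq_sum_univ' z, map_sum]
    refine Finset.sum_congr rfl fun α _ => ?_
    rw [map_smul, smul_eq_mul, hcoeff, mul_comm]
  refine ⟨p, hp, fun x hx => ?_, ?_⟩
  · rw [eval_eq_sum hp, hriesz]
    exact hnonneg _ (eval_mem_momentCone hK hx)
  · rw [riesz, hriesz]
    exact hφy.trans hu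

end Moments

/-! ### Certificates on the sphere and the main equivalence. -/

theorem mem_semialgSet_tilde {n : ℕ} {E I : Type*} {cE : E → MvPolynomial (Fin n) ℝ}
    {cI : I → MvPolynomial (Fin n) ℝ} {z : Fin (n + 1) → ℝ} :
    z ∈ semialgSet (tildeEq cE) (tildeIn cI) ↔ z ∈ homCone cE cI ∧ ∑ i, z i ^ 2 = 1 := by
  simp only [semialgSet, homCone, Set.mem_ofPred_eq, Option.forall, tildeEq, tildeIn, map_sub,
    map_sum, map_pow, MvPolynomial.eval_X, map_one, sub_eq_zero]
  tauto

theorem eval_nonneg_of_homogenizeAt_mem {n : ℕ} {E I : Type*} [Fintype I]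
    {cE : E → MvPolynomial (Fin n) ℝ} {cI : I → MvPolynomial (Fin n) ℝ} {d : ℕ}
    {p : MvPolynomial (Fin n) ℝ} (hp : p ∈ polySpace (expLE n d))
    (h : homogenizeAt d p ∈ (idealOf (tildeEq cE) : Set (MvPolynomial (Fin (n + 1)) ℝ)) +
      qmod (tildeIn cI)) {x : Fin n → ℝ} (hx : x ∈ semialgSet cE cI) :
    0 ≤ MvPolynomial.eval x p := by
  have hs : 0 < 1 + ∑ i, x i ^ 2 :=
    add_pos_of_pos_of_nonneg one_pos (Finset.sum_nonneg fun i _ => sq_nonneg _)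
  -- The factor normalizing `(1, x)` to a unit vector; it is positive, so the form's value there is
  -- `t^d p(x)`.
  let t : ℝ := (√(1 + ∑ i, x i ^ 2))⁻¹
  have ht : 0 < t := inv_pos.2 (Real.sqrt_pos.2 hs)
  let z : Fin (n + 1) → ℝ := Fin.cons t fun i => t * x i
  have hz0 : z 0 = t := rfl
  have hzx : (fun i => z i.succ / z 0) = x := by
    ext i
    exact mul_div_cancel_left₀ _ ht.ne'
  have hz : z ∈ semialgSet (tildeEq cE) (tildeIn cI) := by
    refine mem_semialgSet_tilde.2 ⟨(mem_homCone_iff ht).2 (by rwa [hzx]), ?_⟩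
    rw [Fin.sum_univ_succ]
    simp only [z, Fin.cons_zero, Fin.cons_succ, mul_pow]
    rw [← Finset.mul_sum, ← mul_one_add, inv_pow, Real.sq_sqrt hs.le, inv_mul_cancel₀ hs.ne']
  have := eval_nonneg_of_mem_ideal_add_qmod h hz
  rw [eval_homogenizeAt hp ht.ne', hzx] at this
  exact nonneg_of_mul_nonneg_right this (pow_pos ht d)

end TruncatedMoment

theorem lemma3p9 {n : ℕ} {E I : Type*} [Fintype E] [Fintype I]
    (cE : E → MvPolynomial (Fin n) ℝ) (cI : I → MvPolynomial (Fin n) ℝ)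
    (A : Finset (Fin n →₀ ℕ))
    (hK : TruncatedMoment.ClosedAtInfinity cE cI)
    (hA : ((TruncatedMoment.polySpace A : Set (MvPolynomial (Fin n) ℝ)) ∩
      TruncatedMoment.polyInterior (TruncatedMoment.expLE n (TruncatedMoment.expDeg A))
        (TruncatedMoment.nonnegCone (TruncatedMoment.expLE n (TruncatedMoment.expDeg A))
          (TruncatedMoment.semialgSet cE cI))).Nonempty)
    (y : A → ℝ) :
    y ∉ closure (TruncatedMoment.momentCone A (TruncatedMoment.semialgSet cE cI)) ↔
      ∃ q ∈ TruncatedMoment.polySpace (TruncatedMoment.expTilde A),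
        TruncatedMoment.riesz (TruncatedMoment.expTilde A) (TruncatedMoment.tmsTilde y) q < 0 ∧
        q ∈ (TruncatedMoment.idealOf (TruncatedMoment.tildeEq cE) :
            Set (MvPolynomial (Fin (n + 1)) ℝ)) +
          TruncatedMoment.qmod (TruncatedMoment.tildeIn cI) := by
  open TruncatedMoment in
  constructor
  · intro hy
    obtain ⟨p, hp, hpK, hpy⟩ := exists_riesz_neg (isClosed_semialgSet cE cI) hy
    obtain ⟨f, hfA, hf⟩ := hA
    -- The Riesz value of `p` is strictly negative, which leaves room for a small positive multiple
    -- of `f`.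
    obtain ⟨ε, hε, hεy⟩ : ∃ ε : ℝ, 0 < ε ∧ riesz A y p + ε * riesz A y f < 0 := by
      have hcont : Continuous fun ε : ℝ => riesz A y p + ε * riesz A y f := by fun_prop
      have hev : ∀ᶠ ε in nhds (0 : ℝ), riesz A y p + ε * riesz A y f < 0 :=
        hcont.continuousAt.eventually_lt continuousAt_const (by simpa using hpy)
      obtain ⟨ε, h, hε⟩ := ((Filter.Eventually.filter_mono nhdsWithin_le_nhds hev).and
        (self_mem_nhdsWithin : Set.Ioi (0 : ℝ) ∈ nhdsWithin 0 (Set.Ioi 0))).exists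
      exact ⟨ε, hε, h⟩
    refine ⟨homogenizeAt (expDeg A) (p + ε • f),
      homogenizeAt_mem_polySpace (Submodule.add_mem _ hp (Submodule.smul_mem _ ε hfA)), ?_, ?_⟩
    · rw [riesz_homogenizeAt]
      convert hεy using 1
      simp only [riesz, MvPolynomial.coeff_add, MvPolynomial.coeff_smul, smul_eq_mul, add_mul,
        Finset.sum_add_distrib, Finset.mul_sum, mul_assoc]
    · refine mem_ideal_add_qmod_of_pos (Ideal.subset_span ⟨none, rfl⟩) fun z hz => ?_
      obtain ⟨hzh, hz1⟩ := mem_semialgSet_tilde.1 hz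
      rw [map_add, map_smul, map_add, MvPolynomial.smul_eval]
      refine add_pos_of_nonneg_of_pos
        (eval_homogenizeAt_nonneg hK ⟨polySpace_le_expLE A hp, hpK⟩ hzh)
        (mul_pos hε (eval_homogenizeAt_pos hK hf hzh ?_))
      rintro rfl
      simp at hz1
  · rintro ⟨q, hq, hqy, hqM⟩ hy
    obtain ⟨p, hp, rfl⟩ := exists_homogenizeAt_eq hq
    rw [riesz_homogenizeAt] at hqy
    exact hqy.not_ge (riesz_nonneg_of_mem_closure hy hp fun x hx =>
      eval_nonneg_of_homogenizeAt_mem (polySpace_le_expLE A hp) hqM hx)
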